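/- Let $r\ge 0$ be an integer and let $H=(V,E,w)$ be a finite weighted $r$-uniform hypergraph on $n=|V|$ vertices, where hyperedges with fewer than $r$ distinct endpoints and parallel hyperedges are allowed. A cut is a bipartition $(S,V\setminus S)$ of $V$ into two nonempty sides, and its weight in a weighted hypergraph is the total weight of all hyperedges that intersect both $S$ and $V\setminus S$. Let $\varepsilon\in(0,1]$ and let $d\ge 1$ be real. Let $H'=(V,E',w')$ be a random subhypergraph of $H$ (a hyperedge of $H$ that is absent from $H'$ is regarded as having $w'$-weight $0$) whose hyperedge weights $w'_e$, $e\in E$, are independent random variables, distributed arbitrarily and not necessarily identically in the interval $[0,1]$. Suppose that the expected weight in $H'$ of every cut is at least $$\rho_\varepsilon=\frac{3}{\varepsilon^2}\bigl(r+(d+2)\ln n\bigr).$$ Then with probability at least $1-n^{-d}$, every cut $(S,V\setminus S)$ simultaneously has weight in $H'$ between $(1-\varepsilon)$ and $(1+\varepsilon)$ times its expected weight in $H'$. -/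

import Mathlib

open MeasureTheory ProbabilityTheory

/-- A weighted hypergraph with vertex set `V` and hyperedges labelled by `E`.  The hyperedge `e` has
the set of endpoints `ends e` and the nonnegative weight `weight e`.  Distinct hyperedges may have
the same set of endpoints, so parallel hyperedges are allowed but not required. -/
structure WeightedHypergraph (V E : Type*) where
  /-- the set of endpoints of a hyperedge -/
  ends : E → Finset V
  /-- the weight of a hyperedge -/
  weight : E → ℝ
  weight_nonneg : ∀ e, 0 ≤ weight e

namespace WeightedHypergraph

/-- `H` is `r`-uniform.  Hyperedges with fewer than `r` distinct endpoints are allowed, for instance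
because a hyperedge with `r` endpoints may contain duplicate vertices. -/
def IsUniform {V E : Type*} (H : WeightedHypergraph V E) (r : ℕ) : Prop :=
  ∀ e, (H.ends e).card ≤ r

/-- `H'` is a subhypergraph of `H` (in general with different weights): each hyperedge of `H'` is a
hyperedge of `H`.  A hyperedge of `H` which is absent from `H'` is a hyperedge of weight `0`
in `H'`. -/
def IsSubhypergraph {V E : Type*} (H' H : WeightedHypergraph V E) : Prop :=
  ∀ e, H'.ends e = H.ends e

/-- The weight of the cut `(S, Sᶜ)`: the total weight of all hyperedges that intersect both `S` and
its complement. -/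
def cutWeight {V E : Type*} [Fintype V] [DecidableEq V] [Fintype E]
    (H : WeightedHypergraph V E) (S : Finset V) : ℝ :=
  ∑ e with (H.ends e ∩ S).Nonempty ∧ (H.ends e ∩ Sᶜ).Nonempty, H.weight e

end WeightedHypergraph

/-- The set `S` is one side of a cut `(S, Sᶜ)`: both sides are nonempty. -/
def IsCut {V : Type*} [Fintype V] [DecidableEq V] (S : Finset V) : Prop :=
  S.Nonempty ∧ Sᶜ.Nonempty

/-! Divide the expected weights by `3 / ε ^ 2 * t`, where `t = r + (d + 2) ln n`, so that every cut
has weight `w(S) ≥ 1`. By Chernoff, a cut fails with probability at most `2 exp(-t w(S))`, so a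
union bound reduces everything to `∑ exp(-t w(S)) ≤ n ^ (-d)` over proper nonempty `S`
(`sum_cuts_exp_le`).

That sum is controlled by continuous-time contraction. If each hyperedge is contracted at rate its
weight, `exp(-t w(S))` is the probability that `S` is still a union of components at time `t`, so
`cutSum` is the mean of 2 to the number of components. Singleton cuts force a high contraction rate,
and `cutSum_contractTime_le` turns this into a bound by induction on the number of vertices. The
probabilistic picture is replaced by a differential inequality for `cutSum`. -/

namespace WeightedHypergraph

/-! ### Contraction of hyperedges and cut sums -/

/-- The image of a hypergraph under a map of vertices. -/
def map {V U E : Type*} [DecidableEq U] (H : WeightedHypergraph V E) (f : V → U) :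
    WeightedHypergraph U E where
  ends e := (H.ends e).image f
  weight := H.weight
  weight_nonneg := H.weight_nonneg

theorem cutWeight_map {V U E : Type*} [Fintype V] [DecidableEq V] [Fintype U] [DecidableEq U]
    [Fintype E] (H : WeightedHypergraph V E) (f : V → U) (S : Finset U) :
    (H.map f).cutWeight S = H.cutWeight (Finset.univ.filter fun v => f v ∈ S) := by
  unfold cutWeight
  refine Finset.sum_congr (Finset.filter_congr fun e _ => ?_) fun _ _ => rfl
  simp [map, Finset.Nonempty]

theorem cutWeight_empty {V E : Type*} [Fintype V] [DecidableEq V] [Fintype E]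
    (H : WeightedHypergraph V E) : H.cutWeight ∅ = 0 := by
  simp [cutWeight]

theorem cutWeight_compl {V E : Type*} [Fintype V] [DecidableEq V] [Fintype E]
    (H : WeightedHypergraph V E) (S : Finset V) : H.cutWeight Sᶜ = H.cutWeight S := by
  unfold cutWeight
  refine Finset.sum_congr (Finset.filter_congr fun e _ => ?_) fun _ _ => rfl
  rw [compl_compl, and_comm]

theorem cutWeight_univ {V E : Type*} [Fintype V] [DecidableEq V] [Fintype E]
    (H : WeightedHypergraph V E) : H.cutWeight Finset.univ = 0 := by
  simp [cutWeight]

theorem two_le_card_of_crosses {V : Type*} [Fintype V] [DecidableEq V] {A S : Finset V}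
    (h : (A ∩ S).Nonempty ∧ (A ∩ Sᶜ).Nonempty) : 2 ≤ A.card := by
  obtain ⟨⟨a, ha⟩, ⟨b, hb⟩⟩ := h
  simp only [Finset.mem_inter, Finset.mem_compl] at ha hb
  exact Finset.one_lt_card.2 ⟨a, ha.1, b, hb.1, fun h => hb.2 (h ▸ ha.2)⟩

/-- The map which contracts the set `A` to its element `a`. -/
def contractMap {V : Type*} [DecidableEq V] (A : Finset V) (a : V) (v : V) :
    {v : V // v ∉ A ∨ v = a} :=
  if h : v ∈ A then ⟨a, Or.inr rfl⟩ else ⟨v, Or.inl h⟩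

theorem contractMap_val {V : Type*} [DecidableEq V] {A : Finset V} {a : V}
    (v : {v : V // v ∉ A ∨ v = a}) : contractMap A a v = v := by
  obtain ⟨v, hv⟩ := v
  unfold contractMap
  split_ifs with h
  · rcases hv with hv | rfl
    · exact absurd h hv
    · rfl
  · rfl

theorem card_contract {V : Type*} [Fintype V] [DecidableEq V] {A : Finset V} {a : V}
    (ha : a ∈ A) : Fintype.card {v : V // v ∉ A ∨ v = a} + A.card = Fintype.card V + 1 := by
  have h : (Finset.univ.filter fun v : V => v ∉ A ∨ v = a) = insert a Aᶜ := by
    ext v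
    simp [or_comm]
  rw [Fintype.card_subtype, h, Finset.card_insert_of_notMem (by simpa using ha),
    Finset.card_compl]
  have := Finset.card_le_univ A
  omega

/-- The sum of `exp (-t w(S))` over all vertex sets `S`, where `w(S)` is the weight of the
cut `(S, Sᶜ)`. -/
noncomputable def cutSum {V E : Type*} [Fintype V] [DecidableEq V] [Fintype E]
    (H : WeightedHypergraph V E) (t : ℝ) : ℝ :=
  ∑ S : Finset V, Real.exp (-(t * H.cutWeight S))

/-- The part of `cutSum` which comes from the sets not separating the endpoints of `e`. -/
noncomputable def cutSumAvoiding {V E : Type*} [Fintype V] [DecidableEq V] [Fintype E]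
    (H : WeightedHypergraph V E) (e : E) (t : ℝ) : ℝ :=
  ∑ S : Finset V with ¬ ((H.ends e ∩ S).Nonempty ∧ (H.ends e ∩ Sᶜ).Nonempty),
    Real.exp (-(t * H.cutWeight S))

/-- A set that does not separate `e` contains all of its endpoints or none, so it is the preimage of
a vertex set of the contraction, with the same cut weight. -/
theorem cutSumAvoiding_le {V E : Type*} [Fintype V] [DecidableEq V] [Fintype E]
    (H : WeightedHypergraph V E) (e : E) {a : V} (ha : a ∈ H.ends e) (t : ℝ) :
    H.cutSumAvoiding e t ≤ (H.map (contractMap (H.ends e) a)).cutSum t := by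
  set A := H.ends e with hA
  have key : ∀ S : Finset V, ¬ ((A ∩ S).Nonempty ∧ (A ∩ Sᶜ).Nonempty) →
      (Finset.univ.filter fun v => contractMap A a v ∈
        (Finset.univ.filter fun u : {v : V // v ∉ A ∨ v = a} => (u : V) ∈ S)) = S := by
    intro S hS
    ext v
    simp only [Finset.mem_filter, Finset.mem_univ, true_and, contractMap]
    split_ifs with h
    · simp only [Finset.Nonempty, Finset.mem_inter, Finset.mem_compl, not_and, not_exists] at hS
      constructor
      · intro h1
        by_contra h2
        exact hS ⟨a, ha, h1⟩ v h h2
      · intro h1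
        by_contra h2
        exact hS ⟨v, h, h1⟩ a ha h2
    · rfl
  unfold cutSumAvoiding cutSum
  rw [← hA]
  let g : Finset V → Finset {v : V // v ∉ A ∨ v = a} :=
    fun S => Finset.univ.filter fun u => (u : V) ∈ S
  have hinj : Set.InjOn g ((Finset.univ.filter fun S : Finset V =>
      ¬ ((A ∩ S).Nonempty ∧ (A ∩ Sᶜ).Nonempty) : Finset (Finset V)) : Set (Finset V)) := by
    intro S hS S' hS' h
    simp only [Finset.coe_filter, Finset.mem_univ, true_and, Set.mem_ofPred_eq] at hS hS'
    rw [← key S hS, ← key S' hS']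
    have h' : (Finset.univ.filter fun u : {v : V // v ∉ A ∨ v = a} => (u : V) ∈ S) =
      (Finset.univ.filter fun u : {v : V // v ∉ A ∨ v = a} => (u : V) ∈ S') := h
    rw [h']
  calc _ = ∑ S : Finset V with ¬ ((A ∩ S).Nonempty ∧ (A ∩ Sᶜ).Nonempty),
        Real.exp (-(t * (H.map (contractMap A a)).cutWeight (g S))) := by
        refine Finset.sum_congr rfl fun S hS => ?_
        rw [cutWeight_map, key S (Finset.mem_filter.1 hS).2]
    _ = ∑ S' ∈ (Finset.univ.filter fun S : Finset V =>
        ¬ ((A ∩ S).Nonempty ∧ (A ∩ Sᶜ).Nonempty)).image g,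
        Real.exp (-(t * (H.map (contractMap A a)).cutWeight S')) := by
        rw [Finset.sum_image hinj]
    _ ≤ _ := Finset.sum_le_sum_of_subset_of_nonneg (Finset.subset_univ _)
        fun _ _ _ => (Real.exp_pos _).le

/-! ### The differential inequality for the cut sum -/

/-- The total weight of the hyperedges with at least two endpoints. -/
noncomputable def bigWeight {V E : Type*} [Fintype E] (H : WeightedHypergraph V E) : ℝ :=
  ∑ e with 2 ≤ (H.ends e).card, H.weight e

theorem cutWeight_eq_bigWeight_sub {V E : Type*} [Fintype V] [DecidableEq V] [Fintype E]
    (H : WeightedHypergraph V E) (S : Finset V) :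
    H.cutWeight S = H.bigWeight - ∑ e with 2 ≤ (H.ends e).card,
      if ¬ ((H.ends e ∩ S).Nonempty ∧ (H.ends e ∩ Sᶜ).Nonempty) then H.weight e else 0 := by
  unfold cutWeight bigWeight
  rw [← Finset.sum_sub_distrib, Finset.sum_filter, Finset.sum_filter]
  refine Finset.sum_congr rfl fun e _ => ?_
  by_cases h : (H.ends e ∩ S).Nonempty ∧ (H.ends e ∩ Sᶜ).Nonempty
  · simp [h, two_le_card_of_crosses h]
  · simp [h]

/-- Writing each cut weight as the total weight minus the uncrossed weight leaves a linear decay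
term plus terms that live on contracted hypergraphs, where induction applies. -/
theorem hasDerivAt_cutSum {V E : Type*} [Fintype V] [DecidableEq V] [Fintype E]
    (H : WeightedHypergraph V E) (t : ℝ) :
    HasDerivAt H.cutSum (-(H.bigWeight * H.cutSum t) +
      ∑ e with 2 ≤ (H.ends e).card, H.weight e * H.cutSumAvoiding e t) t := by
  have h1 : HasDerivAt H.cutSum
      (∑ S : Finset V, Real.exp (-(t * H.cutWeight S)) * -(1 * H.cutWeight S)) t := by
    unfold cutSum
    exact HasDerivAt.fun_sum fun S _ => (((hasDerivAt_id t).mul_const _).neg).exp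
  convert h1 using 1
  unfold cutSum cutSumAvoiding
  have h2 : ∀ S : Finset V, Real.exp (-(t * H.cutWeight S)) * -(1 * H.cutWeight S) =
      -(H.bigWeight * Real.exp (-(t * H.cutWeight S))) +
      ∑ e with 2 ≤ (H.ends e).card,
        if ¬ ((H.ends e ∩ S).Nonempty ∧ (H.ends e ∩ Sᶜ).Nonempty) then
          H.weight e * Real.exp (-(t * H.cutWeight S)) else 0 := by
    intro S
    have : (∑ e with 2 ≤ (H.ends e).card,
        if ¬ ((H.ends e ∩ S).Nonempty ∧ (H.ends e ∩ Sᶜ).Nonempty) then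
          H.weight e * Real.exp (-(t * H.cutWeight S)) else 0) =
        (H.bigWeight - H.cutWeight S) * Real.exp (-(t * H.cutWeight S)) := by
      rw [H.cutWeight_eq_bigWeight_sub S, sub_sub_cancel, Finset.sum_mul]
      refine Finset.sum_congr rfl fun e _ => ?_
      rw [ite_mul, zero_mul]
    rw [this]
    ring
  rw [Finset.sum_congr rfl fun S _ => h2 S, Finset.sum_add_distrib, Finset.sum_neg_distrib,
    Finset.mul_sum, Finset.sum_comm]
  congr 1
  refine Finset.sum_congr rfl fun e _ => ?_
  rw [Finset.mul_sum, Finset.sum_filter]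

/-- Double counting of weighted degrees: each vertex, as a singleton cut, has degree at least 1. -/
theorem card_le_sum_weight_mul_card {V E : Type*} [Fintype V] [DecidableEq V] [Fintype E]
    (H : WeightedHypergraph V E) (hV : 2 ≤ Fintype.card V)
    (hcut : ∀ S, IsCut S → 1 ≤ H.cutWeight S) :
    (Fintype.card V : ℝ) ≤ ∑ e with 2 ≤ (H.ends e).card, H.weight e * (H.ends e).card := by
  have hcut1 : ∀ v : V, IsCut {v} := by
    intro v
    refine ⟨Finset.singleton_nonempty v, ?_⟩
    rw [← Finset.card_pos, Finset.card_compl, Finset.card_singleton]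
    omega
  calc (Fintype.card V : ℝ) = ∑ v : V, (1 : ℝ) := by simp
    _ ≤ ∑ v : V, H.cutWeight {v} := Finset.sum_le_sum fun v _ => hcut _ (hcut1 v)
    _ ≤ ∑ v : V, ∑ e with 2 ≤ (H.ends e).card, if v ∈ H.ends e then H.weight e else 0 := by
        refine Finset.sum_le_sum fun v _ => ?_
        unfold cutWeight
        rw [Finset.sum_filter, Finset.sum_filter]
        refine Finset.sum_le_sum fun e _ => ?_
        have hw := H.weight_nonneg e
        split_ifs with h1 h2 h3 h3 <;> try first | exact le_rfl | exact hw
        · obtain ⟨u, hu⟩ := h1.1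
          simp only [Finset.mem_inter, Finset.mem_singleton] at hu
          exact absurd (hu.2 ▸ hu.1) h3
        · exact absurd (two_le_card_of_crosses h1) h2
    _ = _ := by
        rw [Finset.sum_comm]
        refine Finset.sum_congr rfl fun e _ => ?_
        rw [← Finset.sum_filter, Finset.sum_const, nsmul_eq_mul, mul_comm]
        simp

/-- Apply `exp(-x) ≤ 1 / (1 + x)` with `x = θ q`, `q = j - 1`. After clearing denominators, the `r`
term pays for `(q + 1) θ q` and the `2 / θ` term for `q + 1 ≤ 2 q`. -/
theorem le_mul_one_sub_exp {r j : ℕ} (hj : 2 ≤ j) (hjr : j ≤ r) {θ : ℝ} (hθ : 0 < θ) :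
    (j : ℝ) ≤ (r + 2 / θ) * (1 - Real.exp (-(θ * (j - 1)))) := by
  have hj' : (2 : ℝ) ≤ j := by exact_mod_cast hj
  have hjr' : (j : ℝ) ≤ r := by exact_mod_cast hjr
  set q : ℝ := j - 1 with hq
  have hq1 : 1 ≤ q := by linarith
  have hx : 0 < θ * q := by positivity
  have h1 : Real.exp (-(θ * q)) ≤ (1 + θ * q)⁻¹ := by
    rw [Real.exp_neg]
    exact inv_anti₀ (by positivity) (by linarith [Real.add_one_le_exp (θ * q)])
  have h2 : θ * q / (1 + θ * q) ≤ 1 - Real.exp (-(θ * q)) := by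
    have : θ * q / (1 + θ * q) = 1 - (1 + θ * q)⁻¹ := by field_simp; ring
    linarith
  refine le_trans ?_ (mul_le_mul_of_nonneg_left h2 (by positivity))
  have h3 : (r + 2 / θ) * (θ * q / (1 + θ * q)) = (r * θ + 2) * q / (1 + θ * q) := by
    field_simp
  rw [h3, le_div_iff₀ (by positivity)]
  have h4 : (j : ℝ) = q + 1 := by rw [hq]; ring
  have h5 : (q + 1) * (θ * q) ≤ r * (θ * q) :=
    mul_le_mul_of_nonneg_right (by linarith) hx.le
  rw [h4]
  nlinarith

/-- A time at which the contraction process on a hypergraph of rank `r` has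
reached the parameter `θ`. -/
noncomputable def contractTime (r : ℕ) (θ : ℝ) : ℝ :=
  r * (Real.log 2 - θ) + 2 * (Real.log (Real.log 2) - Real.log θ)

theorem hasDerivAt_contractTime (r : ℕ) {θ : ℝ} (hθ : 0 < θ) :
    HasDerivAt (contractTime r) (-(r + 2 / θ)) θ := by
  unfold contractTime
  convert! (((hasDerivAt_id θ).const_sub (Real.log 2)).const_mul (r : ℝ)).add
    (((Real.hasDerivAt_log hθ.ne').const_sub (Real.log (Real.log 2))).const_mul 2) using 1
  ring

/-- Both sides equal `2 ^ k` at `θ = ln 2`, where the time is 0. The speed `r + 2 / θ` of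
`contractTime` is what `le_mul_one_sub_exp` needs to keep the bound valid as `θ` decreases.
Contraction preserves both hypotheses, since uniformity only bounds cardinalities from above. -/
theorem cutSum_contractTime_le {r : ℕ} {E : Type*} [Fintype E] (k : ℕ) :
    ∀ {V : Type*} [Fintype V] [DecidableEq V] (H : WeightedHypergraph V E),
      Fintype.card V = k → 1 ≤ k → H.IsUniform r → (∀ S, IsCut S → 1 ≤ H.cutWeight S) →
      ∀ θ : ℝ, 0 < θ → θ ≤ Real.log 2 →
        H.cutSum (contractTime r θ) ≤ 2 * Real.exp (θ * (k - 1)) := by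
  induction k using Nat.strong_induction_on with
  | _ k ih =>
  intro V _ _ H hk hk1 hr hcut θ₀ hθ₀ hθ₀2
  have hlog2 : 0 < Real.log 2 := Real.log_pos (by norm_num)
  rcases hk1.eq_or_lt with rfl | hk2
  · have hexp : ∀ S : Finset V, Real.exp (-(contractTime r θ₀ * H.cutWeight S)) ≤ 1 := by
      intro S
      have : H.cutWeight S = 0 := by
        refine Finset.sum_eq_zero fun e he => ?_
        have h1 := two_le_card_of_crosses (Finset.mem_filter.1 he).2
        have h2 := Finset.card_le_univ (H.ends e)
        omega
      simp [this]
    calc H.cutSum (contractTime r θ₀) ≤ ∑ S : Finset V, (1 : ℝ) :=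
          Finset.sum_le_sum fun S _ => hexp S
      _ = 2 := by simp [hk]
      _ ≤ _ := by simp
  set W := H.bigWeight with hW
  -- The integrating factor cancels the decay term `-W * cutSum`, so the sign of the derivative
  -- involves only the contracted hypergraphs.
  let F : ℝ → ℝ := fun θ => Real.exp (W * contractTime r θ) *
    (H.cutSum (contractTime r θ) - 2 * Real.exp (θ * (k - 1)))
  have hderiv : ∀ θ : ℝ, 0 < θ → HasDerivAt F (Real.exp (W * contractTime r θ) *
      ((r + 2 / θ) * (W * (2 * Real.exp (θ * (k - 1))) -
        ∑ e with 2 ≤ (H.ends e).card, H.weight e * H.cutSumAvoiding e (contractTime r θ)) -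
        2 * (Real.exp (θ * (k - 1)) * (k - 1)))) θ := by
    intro θ hθ
    have hT := hasDerivAt_contractTime r hθ
    have h1 := (hT.const_mul W).exp
    have h2 := (H.hasDerivAt_cutSum (contractTime r θ)).comp θ hT
    have h3 := (((hasDerivAt_id θ).mul_const ((k : ℝ) - 1)).exp).const_mul 2
    convert! h1.mul (h2.sub h3) using 1
    simp only [Function.comp_def, id, Pi.sub_apply, ← hW]
    ring
  have hnonneg : ∀ θ : ℝ, 0 < θ → θ ≤ Real.log 2 → 0 ≤ Real.exp (W * contractTime r θ) *
      ((r + 2 / θ) * (W * (2 * Real.exp (θ * (k - 1))) -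
        ∑ e with 2 ≤ (H.ends e).card, H.weight e * H.cutSumAvoiding e (contractTime r θ)) -
        2 * (Real.exp (θ * (k - 1)) * (k - 1))) := by
    intro θ hθ hθ2
    refine mul_nonneg (Real.exp_pos _).le (sub_nonneg.2 ?_)
    -- Contracting `e` leaves `k + 1 - |e| < k` vertices, and the induction hypothesis is used at
    -- the same `θ`.
    have hR : ∀ e ∈ Finset.univ.filter fun e => 2 ≤ (H.ends e).card,
        H.cutSumAvoiding e (contractTime r θ) ≤
          2 * (Real.exp (θ * (k - 1)) * Real.exp (-(θ * ((H.ends e).card - 1)))) := by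
      intro e he
      have hj := (Finset.mem_filter.1 he).2
      obtain ⟨a, ha⟩ : (H.ends e).Nonempty := Finset.card_pos.1 (by omega)
      have hc := card_contract ha
      have hle := Finset.card_le_univ (H.ends e)
      refine (H.cutSumAvoiding_le e ha _).trans ?_
      have := ih (Fintype.card {v : V // v ∉ H.ends e ∨ v = a}) (by omega)
        (H.map (contractMap (H.ends e) a)) rfl (by omega)
        (fun f => Finset.card_image_le.trans (hr f)) ?_ θ hθ hθ2
      · rw [← Real.exp_add]
        have hc' : (Fintype.card {v : V // v ∉ H.ends e ∨ v = a} : ℝ) + (H.ends e).card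
          = k + 1 := by rw [← hk]; exact_mod_cast hc
        rwa [show θ * ((k : ℝ) - 1) + -(θ * (((H.ends e).card : ℝ) - 1)) =
          θ * ((Fintype.card {v : V // v ∉ H.ends e ∨ v = a} : ℝ) - 1) by
            linear_combination (-θ) * hc']
      · rintro S ⟨⟨s, hs⟩, ⟨s', hs'⟩⟩
        rw [cutWeight_map]
        refine hcut _ ⟨⟨s, ?_⟩, ⟨s', ?_⟩⟩
        · simpa [contractMap_val] using hs
        · simpa [contractMap_val] using hs'
    have hdeg := H.card_le_sum_weight_mul_card (by omega) hcut
    rw [hk] at hdeg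
    set X := Real.exp (θ * (k - 1)) with hX
    have hXpos : 0 < X := Real.exp_pos _
    have hc : (0 : ℝ) < r + 2 / θ := by positivity
    calc 2 * (X * (k - 1)) ≤ 2 * X * k := by nlinarith
      _ ≤ 2 * X * ∑ e with 2 ≤ (H.ends e).card, H.weight e * (H.ends e).card :=
          mul_le_mul_of_nonneg_left hdeg (by positivity)
      _ ≤ 2 * X * ∑ e with 2 ≤ (H.ends e).card, H.weight e *
            ((r + 2 / θ) * (1 - Real.exp (-(θ * ((H.ends e).card - 1))))) := by
          refine mul_le_mul_of_nonneg_left (Finset.sum_le_sum fun e he => ?_) (by positivity)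
          exact mul_le_mul_of_nonneg_left
            (le_mul_one_sub_exp (Finset.mem_filter.1 he).2 (hr e) hθ) (H.weight_nonneg e)
      _ = (r + 2 / θ) * ∑ e with 2 ≤ (H.ends e).card, (H.weight e * (2 * X) -
            H.weight e * (2 * (X * Real.exp (-(θ * ((H.ends e).card - 1)))))) := by
          rw [Finset.mul_sum, Finset.mul_sum]
          refine Finset.sum_congr rfl fun e _ => ?_
          ring
      _ ≤ _ := by
          refine mul_le_mul_of_nonneg_left ?_ hc.le
          rw [Finset.sum_sub_distrib, ← Finset.sum_mul]
          exact sub_le_sub_left (Finset.sum_le_sum fun e he =>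
            mul_le_mul_of_nonneg_left (hR e he) (H.weight_nonneg e)) _
  have hmono : MonotoneOn F (Set.Ioc 0 (Real.log 2)) := by
    refine monotoneOn_of_deriv_nonneg (convex_Ioc _ _)
      (fun θ hθ => (hderiv θ hθ.1).continuousAt.continuousWithinAt)
      (fun θ hθ => ?_) (fun θ hθ => ?_)
    · rw [interior_Ioc] at hθ
      exact (hderiv θ hθ.1).differentiableAt.differentiableWithinAt
    · rw [interior_Ioc] at hθ
      rw [(hderiv θ hθ.1).deriv]
      exact hnonneg θ hθ.1 hθ.2.le
  have hend : F (Real.log 2) = 0 := by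
    have h0 : contractTime r (Real.log 2) = 0 := by simp [contractTime]
    have h1 : H.cutSum 0 = 2 ^ k := by simp [cutSum, hk]
    have h2 : 2 * Real.exp (Real.log 2 * (k - 1)) = 2 ^ k := by
      have : Real.log 2 * ((k : ℝ) - 1) = k * Real.log 2 - Real.log 2 := by ring
      rw [this, Real.exp_sub, Real.exp_nat_mul, Real.exp_log (by norm_num)]
      ring
    simp only [F, h0, h1, h2, sub_self, mul_zero]
  have hfin : F θ₀ ≤ 0 := hend ▸ hmono ⟨hθ₀, hθ₀2⟩ ⟨hlog2, le_rfl⟩ hθ₀2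
  have := (mul_nonpos_iff_pos_imp_nonpos.1 hfin).1 (Real.exp_pos _)
  linarith

end WeightedHypergraph

/-! ### Chernoff bounds -/

theorem Real.exp_mul_le_of_mem_Icc {x : ℝ} (hx : x ∈ Set.Icc (0 : ℝ) 1) (s : ℝ) :
    Real.exp (s * x) ≤ 1 + x * (Real.exp s - 1) := by
  have h := convexOn_exp.2 (Set.mem_univ 0) (Set.mem_univ s) (sub_nonneg.2 hx.2) hx.1
    (sub_add_cancel 1 x)
  simp only [smul_eq_mul, mul_zero, zero_add, Real.exp_zero, mul_one] at h
  rw [mul_comm s x]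
  linarith

section Chernoff

variable {Ω : Type*} [MeasurableSpace Ω] {μ : Measure Ω} [IsProbabilityMeasure μ]

theorem integrable_of_ae_mem_unitInterval {X : Ω → ℝ} (hX : Measurable X)
    (h : ∀ᵐ ω ∂μ, X ω ∈ Set.Icc (0 : ℝ) 1) : Integrable X μ := by
  refine Integrable.of_bound hX.aestronglyMeasurable 1 ?_
  filter_upwards [h] with ω hω
  rw [Real.norm_eq_abs, abs_le]
  exact ⟨by linarith [hω.1], hω.2⟩

theorem integrable_exp_mul_of_ae_mem_unitInterval {X : Ω → ℝ} (hX : Measurable X)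
    (h : ∀ᵐ ω ∂μ, X ω ∈ Set.Icc (0 : ℝ) 1) (s : ℝ) :
    Integrable (fun ω => Real.exp (s * X ω)) μ := by
  have h1 : Integrable (fun ω => 1 + X ω * (Real.exp s - 1)) μ :=
    (integrable_const 1).add ((integrable_of_ae_mem_unitInterval hX h).mul_const _)
  refine h1.mono' (by fun_prop) ?_
  filter_upwards [h] with ω hω
  rw [Real.norm_eq_abs, Real.abs_exp]
  exact Real.exp_mul_le_of_mem_Icc hω s

theorem mgf_le_exp_of_ae_mem_unitInterval {X : Ω → ℝ} (hX : Measurable X)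
    (h : ∀ᵐ ω ∂μ, X ω ∈ Set.Icc (0 : ℝ) 1) (s : ℝ) :
    mgf X μ s ≤ Real.exp ((∫ ω, X ω ∂μ) * (Real.exp s - 1)) := by
  have hint := integrable_of_ae_mem_unitInterval hX h
  calc mgf X μ s ≤ ∫ ω, (1 + X ω * (Real.exp s - 1)) ∂μ := by
        refine integral_mono_ae (integrable_exp_mul_of_ae_mem_unitInterval hX h s)
          ((integrable_const 1).add (hint.mul_const _)) ?_
        filter_upwards [h] with ω hω
        exact Real.exp_mul_le_of_mem_Icc hω s
    _ = (∫ ω, X ω ∂μ) * (Real.exp s - 1) + 1 := by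
        rw [integral_add (integrable_const 1) (hint.mul_const _), integral_mul_const]
        simp [add_comm]
    _ ≤ _ := Real.add_one_le_exp _

theorem mgf_sum_le_exp_of_ae_mem_unitInterval {ι : Type*} {X : ι → Ω → ℝ}
    (hX : ∀ i, Measurable (X i)) (hindep : iIndepFun X μ)
    (h : ∀ i, ∀ᵐ ω ∂μ, X i ω ∈ Set.Icc (0 : ℝ) 1) (A : Finset ι) (s : ℝ) :
    mgf (∑ i ∈ A, X i) μ s ≤
      Real.exp ((∫ ω, ∑ i ∈ A, X i ω ∂μ) * (Real.exp s - 1)) := by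
  rw [hindep.mgf_sum hX, integral_finsetSum A fun i _ =>
    integrable_of_ae_mem_unitInterval (hX i) (h i), Finset.sum_mul, Real.exp_sum]
  exact Finset.prod_le_prod (fun _ _ => mgf_nonneg)
    fun i _ => mgf_le_exp_of_ae_mem_unitInterval (hX i) (h i) s

/-- The multiplicative Chernoff bound for a sum of independent random variables in `[0, 1]`. -/
theorem measureReal_not_near_mean_le {ι : Type*} {X : ι → Ω → ℝ}
    (hX : ∀ i, Measurable (X i)) (hindep : iIndepFun X μ)
    (h : ∀ i, ∀ᵐ ω ∂μ, X i ω ∈ Set.Icc (0 : ℝ) 1) (A : Finset ι) {ε : ℝ} (hε : 0 < ε)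
    (hε1 : ε ≤ 1) :
    μ.real {ω | ¬ ((1 - ε) * ∫ ω', ∑ i ∈ A, X i ω' ∂μ ≤ ∑ i ∈ A, X i ω ∧
      ∑ i ∈ A, X i ω ≤ (1 + ε) * ∫ ω', ∑ i ∈ A, X i ω' ∂μ)} ≤
      2 * Real.exp (-(ε ^ 2 / 3 * ∫ ω', ∑ i ∈ A, X i ω' ∂μ)) := by
  set m := ∫ ω', ∑ i ∈ A, X i ω' ∂μ with hm
  have hm0 : 0 ≤ m := by
    refine integral_nonneg_of_ae ?_
    filter_upwards [(Finset.eventually_all A).2 fun i _ => h i] with ω hω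
    exact Finset.sum_nonneg fun i hi => (hω i hi).1
  have hint : ∀ s : ℝ, Integrable (fun ω => Real.exp (s * (∑ i ∈ A, X i) ω)) μ := fun s =>
    hindep.integrable_exp_mul_sum hX fun i _ =>
      integrable_exp_mul_of_ae_mem_unitInterval (hX i) (h i) s
  have hmgf := fun s => mgf_sum_le_exp_of_ae_mem_unitInterval hX hindep h A s
  have hlow : μ.real {ω | (∑ i ∈ A, X i) ω ≤ (1 - ε) * m} ≤ Real.exp (-(ε ^ 2 / 3 * m)) := by
    refine (measure_le_le_exp_mul_mgf _ (t := -ε) (by linarith) (hint _)).trans ?_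
    refine (mul_le_mul_of_nonneg_left (hmgf _) (Real.exp_pos _).le).trans ?_
    rw [← Real.exp_add, Real.exp_le_exp, ← hm]
    have h1 : Real.exp (-ε) ≤ 1 - ε + ε ^ 2 / 2 := by
      have := Real.quadratic_le_exp_of_nonneg hε.le
      rw [Real.exp_neg]
      refine (inv_anti₀ (by positivity) this).trans ((inv_le_iff_one_le_mul₀ (by positivity)).2 ?_)
      -- `(1 + ε + ε² / 2) (1 - ε + ε² / 2) = 1 + ε⁴ / 4`.
      nlinarith [sq_nonneg (ε ^ 2)]
    nlinarith [mul_nonneg hm0 (sub_nonneg.2 h1), mul_nonneg hm0 (sq_nonneg ε)]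
  have hup : μ.real {ω | (1 + ε) * m ≤ (∑ i ∈ A, X i) ω} ≤ Real.exp (-(ε ^ 2 / 3 * m)) := by
    have hlog := Real.le_log_one_add_of_nonneg hε.le
    have hlog0 : 0 ≤ Real.log (1 + ε) := Real.log_nonneg (by linarith)
    refine (measure_ge_le_exp_mul_mgf _ hlog0 (hint _)).trans ?_
    refine (mul_le_mul_of_nonneg_left (hmgf _) (Real.exp_pos _).le).trans ?_
    rw [← Real.exp_add, Real.exp_le_exp, ← hm, Real.exp_log (by linarith)]
    -- From `ln(1 + ε) ≥ 2 ε / (ε + 2)`; the slack is a multiple of `ε² (1 - ε)`, hence `ε ≤ 1`.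
    have h1 : ε + ε ^ 2 / 3 ≤ (1 + ε) * Real.log (1 + ε) := by
      refine le_trans ?_ (mul_le_mul_of_nonneg_left hlog (by linarith))
      rw [← mul_div_assoc, le_div_iff₀ (by linarith)]
      nlinarith [sq_nonneg ε, mul_nonneg (sq_nonneg ε) (sub_nonneg.2 hε1)]
    nlinarith [mul_nonneg hm0 (sub_nonneg.2 h1)]
  calc _ ≤ μ.real ({ω | (∑ i ∈ A, X i) ω ≤ (1 - ε) * m} ∪
          {ω | (1 + ε) * m ≤ (∑ i ∈ A, X i) ω}) := by
        refine measureReal_mono fun ω hω => ?_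
        simp only [Set.mem_ofPred_eq, not_and_or, not_le] at hω
        simp only [Set.mem_union, Set.mem_ofPred_eq, Finset.sum_apply]
        exact hω.imp le_of_lt le_of_lt
    _ ≤ _ := measureReal_union_le _ _
    _ ≤ _ := by linarith

end Chernoff

/-! ### The sum over proper cuts -/

namespace WeightedHypergraph

theorem cutSum_eq_sum_cuts_add_two {V E : Type*} [Fintype V] [DecidableEq V] [Fintype E]
    [Nonempty V] (H : WeightedHypergraph V E) (t : ℝ) :
    H.cutSum t = ∑ S ∈ (Finset.univ.erase ∅).erase Finset.univ,
      Real.exp (-(t * H.cutWeight S)) + 2 := by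
  unfold cutSum
  rw [← Finset.add_sum_erase _ _ (Finset.mem_univ (∅ : Finset V)),
    ← Finset.add_sum_erase (Finset.univ.erase ∅) _
      (Finset.mem_erase.2 ⟨Finset.univ_nonempty.ne_empty, Finset.mem_univ _⟩),
    cutWeight_empty, cutWeight_univ]
  simp only [mul_zero, neg_zero, Real.exp_zero]
  ring

theorem mem_cuts_iff {V : Type*} [Fintype V] [DecidableEq V] {S : Finset V} :
    S ∈ ((Finset.univ.erase ∅).erase Finset.univ : Finset (Finset V)) ↔ IsCut S := by
  simp only [Finset.mem_erase, Finset.mem_univ, and_true, IsCut, Finset.nonempty_iff_ne_empty,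
    ne_eq, Finset.compl_eq_empty_iff]
  exact and_comm

/-- The worst case is `r = 2`, `x = 0`, where the left side is `2 (e - 1) (2 ln 2 / e)²`, about
0.89. -/
theorem two_mul_exp_sub_one_mul_le {r : ℕ} (hr : 2 ≤ r) {x : ℝ} (hx : 0 ≤ x) :
    2 * (Real.exp 1 - 1) * Real.exp (-(r * (1 - Real.log 2 + x)) +
      2 * Real.log (Real.log 2)) ≤ 1 := by
  have hr' : (2 : ℝ) ≤ r := by exact_mod_cast hr
  have hl := Real.log_two_gt_d9
  have hu := Real.log_two_lt_d9
  have he := Real.exp_one_gt_d9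
  have he' := Real.exp_one_lt_d9
  have h1 : Real.exp (-(r * (1 - Real.log 2 + x)) + 2 * Real.log (Real.log 2)) ≤
      (2 / Real.exp 1 * Real.log 2) ^ 2 := by
    have : (2 / Real.exp 1 * Real.log 2) ^ 2 =
        Real.exp (2 * (Real.log 2 - 1) + 2 * Real.log (Real.log 2)) := by
      rw [← mul_add, show (2 : ℝ) = (2 : ℕ) by norm_num, Real.exp_nat_mul, Real.exp_add,
        Real.exp_sub, Real.exp_log (by norm_num), Real.exp_log (by norm_num; linarith)]
    rw [this, Real.exp_le_exp]
    nlinarith [mul_nonneg (sub_nonneg.2 hr') (by linarith : (0 : ℝ) ≤ 1 - Real.log 2 + x)]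
  have h2 : 2 / Real.exp 1 * Real.log 2 ≤ 0.5101 := by
    rw [div_mul_eq_mul_div, div_le_iff₀ (Real.exp_pos 1)]
    linarith
  have h3 : 0 ≤ 2 / Real.exp 1 * Real.log 2 := by positivity
  have h4 : (2 / Real.exp 1 * Real.log 2) ^ 2 ≤ 0.5101 ^ 2 := pow_le_pow_left₀ h3 h2 2
  calc _ ≤ 2 * (Real.exp 1 - 1) * 0.5101 ^ 2 :=
        mul_le_mul_of_nonneg_left (h1.trans h4) (by linarith)
    _ ≤ 1 := by norm_num; linarith

theorem sum_cuts_exp_le {V E : Type*} [Fintype V] [DecidableEq V] [Fintype E]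
    (H : WeightedHypergraph V E) {r : ℕ} (hr : 2 ≤ r) (hV : 2 ≤ Fintype.card V)
    (hH : H.IsUniform r) (hcut : ∀ S, IsCut S → 1 ≤ H.cutWeight S) {d : ℝ} (hd : 0 ≤ d) :
    ∑ S ∈ (Finset.univ.erase ∅).erase Finset.univ,
      Real.exp (-((r + (d + 2) * Real.log (Fintype.card V)) * H.cutWeight S)) ≤
      (Fintype.card V : ℝ) ^ (-d) := by
  have : Nonempty V := Fintype.card_pos_iff.1 (by omega)
  set n : ℝ := (Fintype.card V : ℝ) with hn
  have hn2 : (2 : ℝ) ≤ n := by rw [hn]; exact_mod_cast hV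
  have hn0 : 0 < n := by linarith
  have hlogn : 0 ≤ Real.log n := Real.log_nonneg (by linarith)
  have hl := Real.log_two_gt_d9
  have hu := Real.log_two_lt_d9
  set t := r + (d + 2) * Real.log n with ht
  -- At `θ = 1 / n` the cut sum is at most `2 e`, and removing `∅` and `V` leaves `2 (e - 1)`. The
  -- term `-2 ln θ = 2 ln n` accounts for the 2 in `d + 2`. Since cuts weigh at least 1, the
  -- remaining time `t - t₀` gains a factor `exp(-(t - t₀))`.
  set t₀ := contractTime r (1 / n) with ht₀
  have hdiff : t - t₀ = d * Real.log n +
      (r * (1 - Real.log 2 + 1 / n) - 2 * Real.log (Real.log 2)) := by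
    rw [ht, ht₀, contractTime, one_div, Real.log_inv]
    ring
  have hle : t₀ ≤ t := by
    have h1 : Real.log (Real.log 2) ≤ 0 := Real.log_nonpos (by linarith) (by linarith)
    have h2 : (0 : ℝ) ≤ r * (1 - Real.log 2 + 1 / n) :=
      mul_nonneg (Nat.cast_nonneg r) (by linarith [one_div_pos.2 hn0])
    nlinarith [mul_nonneg hd hlogn]
  have hn1 : 1 / n ≤ Real.log 2 := by
    have : 1 / n ≤ 1 / 2 := one_div_le_one_div_of_le (by norm_num) hn2
    linarith
  have hmain := cutSum_contractTime_le (Fintype.card V) H rfl (by omega) hH hcut (1 / n)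
    (by positivity) hn1
  rw [cutSum_eq_sum_cuts_add_two, ← ht₀] at hmain
  have hexp : Real.exp (1 / n * (n - 1)) ≤ Real.exp 1 := by
    rw [Real.exp_le_exp]
    have : 1 / n * (n - 1) = 1 - 1 / n := by field_simp
    linarith [one_div_pos.2 hn0]
  calc _ ≤ ∑ S ∈ (Finset.univ.erase ∅).erase Finset.univ,
        Real.exp (-(t - t₀)) * Real.exp (-(t₀ * H.cutWeight S)) := by
        refine Finset.sum_le_sum fun S hS => ?_
        rw [← Real.exp_add, Real.exp_le_exp]
        nlinarith [mul_nonneg (sub_nonneg.2 hle) (sub_nonneg.2 (hcut S (mem_cuts_iff.1 hS)))]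
    _ = Real.exp (-(t - t₀)) * ∑ S ∈ (Finset.univ.erase ∅).erase Finset.univ,
        Real.exp (-(t₀ * H.cutWeight S)) := by rw [Finset.mul_sum]
    _ ≤ Real.exp (-(t - t₀)) * (2 * (Real.exp 1 - 1)) :=
        mul_le_mul_of_nonneg_left (by linarith) (Real.exp_pos _).le
    _ = n ^ (-d) * (2 * (Real.exp 1 - 1) * Real.exp (-(r * (1 - Real.log 2 + 1 / n)) +
        2 * Real.log (Real.log 2))) := by
        rw [Real.rpow_def_of_pos hn0, hdiff, show -(d * Real.log n +
          (r * (1 - Real.log 2 + 1 / n) - 2 * Real.log (Real.log 2))) = Real.log n * -d +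
          (-(r * (1 - Real.log 2 + 1 / n)) + 2 * Real.log (Real.log 2)) by ring, Real.exp_add]
        ring
    _ ≤ n ^ (-d) * 1 := mul_le_mul_of_nonneg_left
        (two_mul_exp_sub_one_mul_le hr (by positivity)) (by positivity)
    _ = _ := mul_one _

/-- Counting each bipartition once, by its side containing `v`, absorbs the factor 2 of the
two-sided Chernoff bound. -/
theorem sum_cuts_eq_two_mul {V : Type*} [Fintype V] [DecidableEq V] (f : Finset V → ℝ)
    (hf : ∀ S, f Sᶜ = f S) (v : V) :
    ∑ S ∈ (Finset.univ.erase ∅).erase Finset.univ, f S =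
      ∑ S ∈ ((Finset.univ.erase ∅).erase Finset.univ).filter (v ∈ ·), 2 * f S := by
  rw [← Finset.sum_filter_add_sum_filter_not _ (v ∈ ·), ← Finset.mul_sum, two_mul]
  congr 1
  refine Finset.sum_nbij' (fun S => Sᶜ) (fun S => Sᶜ) ?_ ?_ (fun S _ => compl_compl S)
    (fun S _ => compl_compl S) (fun S _ => (hf S).symm)
  all_goals
    intro S hS
    simp only [Finset.mem_filter, mem_cuts_iff, IsCut, compl_compl, Finset.mem_compl] at hS ⊢
    tauto

/-- The hypergraph with the same hyperedges as `H` and weights `w`. -/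
def withWeight {V E : Type*} (H : WeightedHypergraph V E) (w : E → ℝ) (hw : ∀ e, 0 ≤ w e) :
    WeightedHypergraph V E where
  ends := H.ends
  weight := w
  weight_nonneg := hw

end WeightedHypergraph

/-! ### Rescaling and the union bound -/

theorem theorem7 {V E Ω : Type*} [Fintype V] [DecidableEq V] [Fintype E]
    [MeasurableSpace Ω] (μ : Measure Ω) [IsProbabilityMeasure μ]
    (r : ℕ) (ε d : ℝ) (hε : 0 < ε) (hε1 : ε ≤ 1) (hd : 1 ≤ d)
    (H : WeightedHypergraph V E) (hH : H.IsUniform r)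
    (H' : Ω → WeightedHypergraph V E) (hsub : ∀ ω, (H' ω).IsSubhypergraph H)
    (hmeas : ∀ e, Measurable fun ω => (H' ω).weight e)
    (hindep : iIndepFun (fun (e : E) (ω : Ω) => (H' ω).weight e) μ)
    (hunit : ∀ e, ∀ᵐ ω ∂μ, (H' ω).weight e ∈ Set.Icc (0 : ℝ) 1)
    (hcut : ∀ S : Finset V, IsCut S →
      3 / ε ^ 2 * (r + (d + 2) * Real.log (Fintype.card V)) ≤ ∫ ω, (H' ω).cutWeight S ∂μ) :
    1 - (Fintype.card V : ℝ) ^ (-d) ≤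
      μ.real {ω | ∀ S : Finset V, IsCut S →
        (1 - ε) * ∫ ω', (H' ω').cutWeight S ∂μ ≤ (H' ω).cutWeight S ∧
          (H' ω).cutWeight S ≤ (1 + ε) * ∫ ω', (H' ω').cutWeight S ∂μ} := by
  rcases lt_or_ge (Fintype.card V) 2 with hV | hV
  · have hno : ∀ S : Finset V, ¬ IsCut S := by
      rintro S ⟨h1, h2⟩
      have h3 := Finset.card_add_card_compl S
      have h4 := Finset.card_pos.2 h1
      have h5 := Finset.card_pos.2 h2
      omega
    have : {ω | ∀ S : Finset V, IsCut S →
        (1 - ε) * ∫ ω', (H' ω').cutWeight S ∂μ ≤ (H' ω).cutWeight S ∧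
          (H' ω).cutWeight S ≤ (1 + ε) * ∫ ω', (H' ω').cutWeight S ∂μ} = Set.univ :=
      Set.eq_univ_of_forall fun ω S hS => absurd hS (hno S)
    rw [this, probReal_univ]
    have : 0 ≤ (Fintype.card V : ℝ) ^ (-d) := by positivity
    linarith
  let A : Finset V → Finset E := fun S =>
    Finset.univ.filter fun e => (H.ends e ∩ S).Nonempty ∧ (H.ends e ∩ Sᶜ).Nonempty
  have hA : ∀ ω S, (H' ω).cutWeight S = ∑ e ∈ A S, (H' ω).weight e := by
    intro ω S
    refine Finset.sum_congr (Finset.filter_congr fun e _ => ?_) fun _ _ => rfl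
    rw [hsub ω e]
  simp only [hA] at hcut ⊢
  have hn2 : (2 : ℝ) ≤ Fintype.card V := by exact_mod_cast hV
  have hlogn : 0 < Real.log (Fintype.card V) := Real.log_pos (by linarith)
  set t := r + (d + 2) * Real.log (Fintype.card V) with ht
  have ht0 : 0 < t := by positivity
  obtain ⟨v⟩ : Nonempty V := Fintype.card_pos_iff.1 (by omega)
  -- For `r ≤ 1` no hyperedge crosses a cut, contradicting the positive lower bound on a singleton
  -- cut.
  have hr : 2 ≤ r := by
    have hv : IsCut ({v} : Finset V) := by
      refine ⟨Finset.singleton_nonempty v, ?_⟩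
      rw [← Finset.card_pos, Finset.card_compl, Finset.card_singleton]
      omega
    by_contra hr
    have hempty : A {v} = ∅ := by
      refine Finset.filter_eq_empty_iff.2 fun e _ he => ?_
      have := WeightedHypergraph.two_le_card_of_crosses he
      have := hH e
      omega
    have h1 := hcut _ hv
    have h2 : 0 < 3 / ε ^ 2 * t := by positivity
    simp only [hempty, Finset.sum_empty, integral_zero] at h1
    linarith
  have hint := fun e => integrable_of_ae_mem_unitInterval (hmeas e) (hunit e)
  have hscale : 0 ≤ ε ^ 2 / (3 * t) := by positivity
  let G : WeightedHypergraph V E := H.withWeight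
    (fun e => ε ^ 2 / (3 * t) * ∫ ω, (H' ω).weight e ∂μ)
    fun e => mul_nonneg hscale (integral_nonneg fun ω => (H' ω).weight_nonneg e)
  have hG : ∀ S, G.cutWeight S = ε ^ 2 / (3 * t) * ∫ ω, ∑ e ∈ A S, (H' ω).weight e ∂μ := by
    intro S
    rw [integral_finsetSum _ fun e _ => hint e, Finset.mul_sum]
    rfl
  have hGcut : ∀ S, IsCut S → 1 ≤ G.cutWeight S := by
    intro S hS
    rw [hG]
    refine le_trans (le_of_eq ?_) (mul_le_mul_of_nonneg_left (hcut S hS) hscale)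
    field_simp
  have hsum := G.sum_cuts_exp_le hr hV hH hGcut (by linarith : 0 ≤ d)
  rw [← ht, WeightedHypergraph.sum_cuts_eq_two_mul _
    (fun S => by rw [WeightedHypergraph.cutWeight_compl]) v] at hsum
  let bad : Finset V → Set Ω := fun S =>
    {ω | ¬ ((1 - ε) * ∫ ω', ∑ e ∈ A S, (H' ω').weight e ∂μ ≤ ∑ e ∈ A S, (H' ω).weight e ∧
      ∑ e ∈ A S, (H' ω).weight e ≤ (1 + ε) * ∫ ω', ∑ e ∈ A S, (H' ω').weight e ∂μ)}
  have hbad : ∀ S, μ.real (bad S) ≤ 2 * Real.exp (-(t * G.cutWeight S)) := by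
    intro S
    refine (measureReal_not_near_mean_le hmeas hindep hunit (A S) hε hε1).trans
      (le_of_eq ?_)
    rw [hG, show t * (ε ^ 2 / (3 * t) * ∫ ω, ∑ e ∈ A S, (H' ω).weight e ∂μ) =
      ε ^ 2 / 3 * ∫ ω, ∑ e ∈ A S, (H' ω).weight e ∂μ by field_simp]
  have hAcompl : ∀ S, A Sᶜ = A S := by
    intro S
    refine Finset.filter_congr fun e _ => ?_
    rw [compl_compl, and_comm]
  set good := {ω | ∀ S : Finset V, IsCut S →
    (1 - ε) * ∫ ω', ∑ e ∈ A S, (H' ω').weight e ∂μ ≤ ∑ e ∈ A S, (H' ω).weight e ∧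
      ∑ e ∈ A S, (H' ω).weight e ≤ (1 + ε) * ∫ ω', ∑ e ∈ A S, (H' ω').weight e ∂μ} with hgood
  set C := (((Finset.univ.erase ∅).erase Finset.univ : Finset (Finset V))).filter (v ∈ ·)
    with hC
  have hcover : Set.univ ⊆ good ∪ ⋃ S ∈ C, bad S := by
    intro ω _
    by_contra hω
    simp only [Set.mem_union, Set.mem_iUnion, not_or, not_exists] at hω
    refine hω.1 fun S hS => ?_
    by_cases hv : v ∈ S
    · exact not_not.1 (hω.2 S (Finset.mem_filter.2
        ⟨WeightedHypergraph.mem_cuts_iff.2 hS, hv⟩))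
    · have hS' : IsCut Sᶜ := ⟨hS.2, by rw [compl_compl]; exact hS.1⟩
      have h1 := not_not.1 (hω.2 Sᶜ (Finset.mem_filter.2
        ⟨WeightedHypergraph.mem_cuts_iff.2 hS', Finset.mem_compl.2 hv⟩))
      rwa [hAcompl] at h1
  have h1 : (1 : ℝ) ≤ μ.real good + ∑ S ∈ C, μ.real (bad S) := by
    rw [← probReal_univ (μ := μ)]
    exact (measureReal_mono hcover).trans ((measureReal_union_le _ _).trans
      (add_le_add le_rfl (measureReal_biUnion_finset_le _ _)))
  have h2 := Finset.sum_le_sum fun S (_ : S ∈ C) => hbad S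
  linarith
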